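/- Let $\Omega\subset\mathbb{R}^2$ be an open bounded polygon whose boundary is a simple closed chain of straight edges $\Gamma_1,\dots,\Gamma_m$, let $\mathcal D\subseteq\{1,\dots,m\}$ be nonempty, $\Gamma_{\mathcal D}=\bigcup_{i\in\mathcal D}\Gamma_i$, and let $H^1_{\mathcal D}(\Omega)$ be the space of all $v\in H^1(\Omega)$ whose trace vanishes on $\Gamma_{\mathcal D}$. Let $q\in\mathbb{N}_0$, $\lambda>0$ and $f\in L^{2(q+1)/(2q+1)}(\Omega)$, and put $$a(v,w)=\int_\Omega\nabla v\cdot\nabla w\,dx,\qquad b(u;v)=\int_\Omega u^{2q+1}v\,dx\qquad(u,v,w\in H^1_{\mathcal D}(\Omega)).$$ Let $C_q(\Omega)>0$ be a constant of the Sobolev embedding, i.e. $\|v\|_{L^{2(q+1)}(\Omega)}\le C_q(\Omega)\|\nabla v\|_{L^2(\Omega)}$ for all $v\in H^1_{\mathcal D}(\Omega)$, and let $\rho=C_q(\Omega)\|f\|_{L^{2(q+1)/(2q+1)}(\Omega)}$. Let $\mathbb{W}\subset H^1_{\mathcal D}(\Omega)$ be a finite-dimensional subspace and let $U\in\mathbb{W}$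 be the solution of the Galerkin formulation $$a(U,v)+\lambda b(U;v)=\int_\Omega fv\,dx\qquad\forall v\in\mathbb{W}.$$ **Proposition 3.3 (Contraction of the ILG procedure).** Let $U_0\in H^1_{\mathcal D}(\Omega)$ be any initial guess (not necessarily in $\mathbb{W}$), let $$L=\lambda(2q+1)\,C_q(\Omega)^{2(q+1)}\bigl(2\rho+\|\nabla U_0\|_{L^2(\Omega)}\bigr)^{2q},\qquad \alpha\in(0,1]\cap\bigl(0,\tfrac{2}{L^2+1}\bigr),$$ and let $U_1,U_2,\ldots\in\mathbb{W}$ be given by the Picard (Zarantonello) iteration $$a(U_{n+1},v)=(1-\alpha)\,a(U_n,v)+\alpha\Bigl(\int_\Omega fv\,dx-\lambda b(U_n;v)\Bigr)\qquad\forall v\in\mathbb{W},\ n\ge0.$$ Then, with $r_\alpha=\sqrt{(1-\alpha)^2+\alpha^2L^2}$, one has $r_\alpha<1$ and $$\|\nabla(U-U_{n+1})\|_{L^2(\Omega)}\le r_\alpha^{\,n+1}\,\|\nabla(U-U_0)\|_{L^2(\Omega)}\qquad\forall n\ge0.$$ In particular, $\lim_{n\to\infty}\|\nabla(U-U_n)\|_{L^2(\Omega)}=0$,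 and $U_n\to U$ strongly in $H^1_{\mathcal D}(\Omega)$. -/

import Mathlib

open MeasureTheory Filter Topology
open scoped ENNReal ContDiff InnerProductSpace

noncomputable section

namespace SemilinearILG

/-- The Euclidean plane. -/
abbrev Plane : Type := EuclideanSpace ℝ (Fin 2)

/-- `Ω` is the open bounded polygon with consecutive corners `P 0, …, P (m - 1)`: the closed
polygonal chain with edges `P.edgeSet ℝ i = [P i, P (i + 1)]` (indices modulo `m`) is simple, and
`Ω` is the bounded open set with that chain as its boundary (i.e. the inside of the chain). -/
structure IsOpenPolygon {m : ℕ} (P : Polygon Plane m) (Ω : Set Plane) : Prop where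
  three_le : 3 ≤ m
  nondegenerate : P.HasNondegenerateEdges
  consecutive : ∀ i, P.edgeSet ℝ i ∩ P.edgeSet ℝ (finRotate m i) = {P (finRotate m i)}
  nonconsecutive : ∀ i j, i ≠ j → j ≠ finRotate m i → i ≠ finRotate m j →
    Disjoint (P.edgeSet ℝ i) (P.edgeSet ℝ j)
  isOpen : IsOpen Ω
  isBounded : Bornology.IsBounded Ω
  frontier_eq : frontier Ω = P.boundary ℝ

/-- The part `Γ_D` of the boundary that is made of the edges with index in `D`. -/
def edgeUnion {m : ℕ} (P : Polygon Plane m) (D : Set (Fin m)) : Set Plane :=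
  ⋃ i ∈ D, P.edgeSet ℝ i

/-- `L²(Ω) × L²(Ω; ℝ²)` with the Hilbert norm `(‖v‖² + ‖g‖²)^(1/2)`. A weakly differentiable
function `v` is represented by the pair `(v, ∇v)`; on such pairs this is the `H¹(Ω)`-norm. -/
abbrev L2Pair (Ω : Set Plane) : Type :=
  WithLp 2 (Lp ℝ 2 (volume.restrict Ω) × Lp Plane 2 (volume.restrict Ω))

/-- `g` is the weak gradient of `v` in `Ω`: integration by parts against all test functions in
`C_c^∞(Ω)`. -/
def IsWeakGradient (Ω : Set Plane) (v : Lp ℝ 2 (volume.restrict Ω))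
    (g : Lp Plane 2 (volume.restrict Ω)) : Prop :=
  ∀ φ : Plane → ℝ, ContDiff ℝ ∞ φ → HasCompactSupport φ → tsupport φ ⊆ Ω →
    ∫ x in Ω, v x • gradient φ x = - ∫ x in Ω, φ x • g x

/-- `v ∈ H¹(Ω)` (given with its gradient) has zero trace on the subset `S` of the boundary. The
trace operator is the continuous extension of the restriction to the boundary of functions that are
smooth up to the boundary: there are smooth `φ k` that converge to `v` in `H¹(Ω)` and whose
restrictions to `S` converge to zero in `L²(S)` with respect to arc length. -/
def HasZeroTraceOn (Ω S : Set Plane) (v : L2Pair Ω) : Prop :=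
  ∃ φ : ℕ → Plane → ℝ, (∀ k, ContDiff ℝ ∞ (φ k)) ∧
    Tendsto (fun k => eLpNorm (fun x => φ k x - v.fst x) 2 (volume.restrict Ω)) atTop (𝓝 0) ∧
    Tendsto (fun k => eLpNorm (fun x => gradient (φ k) x - v.snd x) 2 (volume.restrict Ω))
      atTop (𝓝 0) ∧
    Tendsto (fun k => eLpNorm (φ k) 2 ((Measure.hausdorffMeasure 1).restrict S)) atTop (𝓝 0)

theorem continuous_gradient {φ : Plane → ℝ} (h : ContDiff ℝ ∞ φ) : Continuous (gradient φ) :=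
  (InnerProductSpace.toDual ℝ Plane).symm.continuous.comp (h.continuous_fderiv (by simp))

theorem gradient_add' {φ ψ : Plane → ℝ} (hφ : ContDiff ℝ ∞ φ) (hψ : ContDiff ℝ ∞ ψ) (x : Plane) :
    gradient (fun y => φ y + ψ y) x = gradient φ x + gradient ψ x := by
  have h1 := (hφ.differentiable (by simp)) x
  have h2 := (hψ.differentiable (by simp)) x
  simp only [gradient]
  rw [show (fun y => φ y + ψ y) = φ + ψ from rfl, fderiv_add h1 h2, map_add]

theorem gradient_const_mul' {φ : Plane → ℝ} (hφ : ContDiff ℝ ∞ φ) (c : ℝ) (x : Plane) :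
    gradient (fun y => c * φ y) x = c • gradient φ x := by
  have h1 := (hφ.differentiable (by simp)) x
  simp only [gradient]
  rw [fderiv_const_mul h1]
  simp

theorem integrable_smul_gradient {Ω : Set Plane} (v : Lp ℝ 2 (volume.restrict Ω)) {φ : Plane → ℝ}
    (h : ContDiff ℝ ∞ φ) (hc : HasCompactSupport φ) :
    Integrable (fun x => v x • gradient φ x) (volume.restrict Ω) := by
  have hs : HasCompactSupport (gradient φ) := by
    have := hc.fderiv (𝕜 := ℝ)
    exact this.comp_left (g := (InnerProductSpace.toDual ℝ Plane).symm) (map_zero _)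
  have h2 : MemLp (gradient φ) 2 (volume.restrict Ω) :=
    (continuous_gradient h).memLp_of_hasCompactSupport hs
  exact memLp_one_iff_integrable.mp (h2.smul (p := 2) (q := 2) (r := 1) (Lp.memLp v))

theorem integrable_test_smul {Ω : Set Plane} (g : Lp Plane 2 (volume.restrict Ω)) {φ : Plane → ℝ}
    (h : ContDiff ℝ ∞ φ) (hc : HasCompactSupport φ) :
    Integrable (fun x => φ x • g x) (volume.restrict Ω) := by
  have h2 : MemLp φ 2 (volume.restrict Ω) := h.continuous.memLp_of_hasCompactSupport hc
  exact memLp_one_iff_integrable.mp ((Lp.memLp g).smul (p := 2) (q := 2) (r := 1) h2)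

/-- The Sobolev space `H¹(Ω)`, as the space of pairs `(v, ∇v)`. -/
def H1 (Ω : Set Plane) : Submodule ℝ (L2Pair Ω) where
  carrier := {v | IsWeakGradient Ω v.fst v.snd}
  zero_mem' := by
    intro φ _ _ _
    have h1 : ∫ x in Ω, ((0 : L2Pair Ω).fst : Plane → ℝ) x • gradient φ x = 0 := by
      refine integral_eq_zero_of_ae ?_
      filter_upwards [Lp.coeFn_zero ℝ 2 (volume.restrict Ω)] with x hx
      rw [WithLp.zero_fst, hx, Pi.zero_apply, zero_smul, Pi.zero_apply]
    have h2 : ∫ x in Ω, φ x • ((0 : L2Pair Ω).snd : Plane → Plane) x = 0 := by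
      refine integral_eq_zero_of_ae ?_
      filter_upwards [Lp.coeFn_zero Plane 2 (volume.restrict Ω)] with x hx
      rw [WithLp.zero_snd, hx, Pi.zero_apply, smul_zero]
    rw [h1, h2, neg_zero]
  add_mem' := by
    intro u w hu hw φ h hc hs
    have h1 : ∫ x in Ω, (u + w).fst x • gradient φ x
        = ∫ x in Ω, (u.fst x • gradient φ x + w.fst x • gradient φ x) := by
      refine integral_congr_ae ?_
      filter_upwards [Lp.coeFn_add u.fst w.fst] with x hx
      simp only [WithLp.add_fst, hx, Pi.add_apply, add_smul]
    have h2 : ∫ x in Ω, φ x • (u + w).snd x = ∫ x in Ω, (φ x • u.snd x + φ x • w.snd x) := by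
      refine integral_congr_ae ?_
      filter_upwards [Lp.coeFn_add u.snd w.snd] with x hx
      simp only [WithLp.add_snd, hx, Pi.add_apply, smul_add]
    rw [h1, h2, integral_add (integrable_smul_gradient _ h hc) (integrable_smul_gradient _ h hc),
      integral_add (integrable_test_smul _ h hc) (integrable_test_smul _ h hc),
      hu φ h hc hs, hw φ h hc hs, neg_add]
  smul_mem' := by
    intro c u hu φ h hc hs
    have h1 : ∫ x in Ω, (c • u).fst x • gradient φ x
        = ∫ x in Ω, c • (u.fst x • gradient φ x) := by
      refine integral_congr_ae ?_
      filter_upwards [Lp.coeFn_smul c u.fst] with x hx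
      simp only [WithLp.smul_fst, hx, Pi.smul_apply, smul_assoc]
    have h2 : ∫ x in Ω, φ x • (c • u).snd x = ∫ x in Ω, c • (φ x • u.snd x) := by
      refine integral_congr_ae ?_
      filter_upwards [Lp.coeFn_smul c u.snd] with x hx
      simp only [WithLp.smul_snd, hx, Pi.smul_apply, smul_comm c]
    rw [h1, h2, integral_smul, integral_smul, hu φ h hc hs, smul_neg]

theorem tendsto_eLpNorm_add {α F : Type*} [MeasurableSpace α] [NormedAddCommGroup F]
    {μ : Measure α} {a b s : ℕ → α → F} (ha : ∀ k, AEStronglyMeasurable (a k) μ)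
    (hb : ∀ k, AEStronglyMeasurable (b k) μ) (hs : ∀ k, s k =ᵐ[μ] a k + b k)
    (ha0 : Tendsto (fun k => eLpNorm (a k) 2 μ) atTop (𝓝 0))
    (hb0 : Tendsto (fun k => eLpNorm (b k) 2 μ) atTop (𝓝 0)) :
    Tendsto (fun k => eLpNorm (s k) 2 μ) atTop (𝓝 0) := by
  have h := ha0.add hb0
  rw [add_zero] at h
  refine tendsto_of_tendsto_of_tendsto_of_le_of_le tendsto_const_nhds h (fun _ => zero_le) ?_
  intro k
  simp only
  rw [eLpNorm_congr_ae (hs k)]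
  exact eLpNorm_add_le (ha k) (hb k) (by norm_num)

theorem tendsto_eLpNorm_smul {α F : Type*} [MeasurableSpace α] [NormedAddCommGroup F]
    [NormedSpace ℝ F] {μ : Measure α} {a s : ℕ → α → F} (c : ℝ) (hs : ∀ k, s k =ᵐ[μ] c • a k)
    (ha0 : Tendsto (fun k => eLpNorm (a k) 2 μ) atTop (𝓝 0)) :
    Tendsto (fun k => eLpNorm (s k) 2 μ) atTop (𝓝 0) := by
  have h := ENNReal.Tendsto.const_mul (a := ‖c‖ₑ) ha0 (Or.inr enorm_ne_top)
  rw [mul_zero] at h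
  refine h.congr (fun k => ?_)
  rw [eLpNorm_congr_ae (hs k), eLpNorm_const_smul]

/-- The space `H¹_D(Ω)` of functions in `H¹(Ω)` with zero trace on `S = Γ_D`. -/
def H1D (Ω S : Set Plane) : Submodule ℝ (L2Pair Ω) where
  carrier := {v | v ∈ H1 Ω ∧ HasZeroTraceOn Ω S v}
  zero_mem' := by
    refine ⟨(H1 Ω).zero_mem, fun _ _ => 0, fun _ => contDiff_const, ?_, ?_, ?_⟩
    · refine tendsto_const_nhds.congr (fun k => ?_)
      symm
      rw [← eLpNorm_zero (α := Plane) (ε := ℝ) (p := 2) (μ := volume.restrict Ω)]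
      refine eLpNorm_congr_ae ?_
      filter_upwards [Lp.coeFn_zero ℝ 2 (volume.restrict Ω)] with x hx
      rw [WithLp.zero_fst, hx]
      simp
    · refine tendsto_const_nhds.congr (fun k => ?_)
      symm
      rw [← eLpNorm_zero (α := Plane) (ε := Plane) (p := 2) (μ := volume.restrict Ω)]
      refine eLpNorm_congr_ae ?_
      filter_upwards [Lp.coeFn_zero Plane 2 (volume.restrict Ω)] with x hx
      rw [WithLp.zero_snd, hx]
      simp [gradient]
    · simp
  add_mem' := by
    rintro u w ⟨hu, φ, hφ, h1, h2, h3⟩ ⟨hw, ψ, hψ, k1, k2, k3⟩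
    refine ⟨(H1 Ω).add_mem hu hw, fun k x => φ k x + ψ k x, fun k => (hφ k).add (hψ k), ?_, ?_, ?_⟩
    · refine tendsto_eLpNorm_add
        (fun k => (hφ k).continuous.aestronglyMeasurable.sub (Lp.aestronglyMeasurable _))
        (fun k => (hψ k).continuous.aestronglyMeasurable.sub (Lp.aestronglyMeasurable _))
        (fun k => ?_) h1 k1
      filter_upwards [Lp.coeFn_add u.fst w.fst] with x hx
      simp only [WithLp.add_fst, hx, Pi.add_apply, Pi.sub_apply]
      ring
    · refine tendsto_eLpNorm_add
        (fun k => (continuous_gradient (hφ k)).aestronglyMeasurable.sub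
          (Lp.aestronglyMeasurable _))
        (fun k => (continuous_gradient (hψ k)).aestronglyMeasurable.sub
          (Lp.aestronglyMeasurable _))
        (fun k => ?_) h2 k2
      filter_upwards [Lp.coeFn_add u.snd w.snd] with x hx
      simp only [WithLp.add_snd, hx, Pi.add_apply, Pi.sub_apply,
        gradient_add' (hφ k) (hψ k)]
      abel
    · exact tendsto_eLpNorm_add (fun k => (hφ k).continuous.aestronglyMeasurable)
        (fun k => (hψ k).continuous.aestronglyMeasurable) (fun k => Eventually.of_forall
          (fun x => rfl)) h3 k3
  smul_mem' := by
    rintro c u ⟨hu, φ, hφ, h1, h2, h3⟩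
    refine ⟨(H1 Ω).smul_mem c hu, fun k x => c * φ k x, fun k => contDiff_const.mul (hφ k),
      ?_, ?_, ?_⟩
    · refine tendsto_eLpNorm_smul c (fun k => ?_) h1
      filter_upwards [Lp.coeFn_smul c u.fst] with x hx
      simp only [WithLp.smul_fst, hx, Pi.smul_apply, smul_eq_mul]
      ring
    · refine tendsto_eLpNorm_smul c (fun k => ?_) h2
      filter_upwards [Lp.coeFn_smul c u.snd] with x hx
      simp only [WithLp.smul_snd, hx, Pi.smul_apply, gradient_const_mul' (hφ k), smul_sub]
    · exact tendsto_eLpNorm_smul c (fun k => Eventually.of_forall (fun x => rfl)) h3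

variable {Ω : Set Plane}

/-- `‖∇v‖` in `L²(Ω)`. -/
def gradNorm (v : L2Pair Ω) : ℝ := ‖v.snd‖

/-- The bilinear form `a(v, w) = ∫_Ω ∇v · ∇w`. -/
def formA (v w : L2Pair Ω) : ℝ := ∫ x in Ω, ⟪v.snd x, w.snd x⟫_ℝ

/-- The form `b(u; v) = ∫_Ω u^(2q+1) v`. -/
def formB (q : ℕ) (u v : L2Pair Ω) : ℝ := ∫ x in Ω, (u.fst x) ^ (2 * q + 1) * v.fst x

/-- The load functional `v ↦ ∫_Ω f v`. -/
def load (f : Plane → ℝ) (v : L2Pair Ω) : ℝ := ∫ x in Ω, f x * v.fst x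

/-- `C > 0` is an embedding constant of `H¹_D(Ω)` into `L^{2(q+1)}(Ω)`:
`‖v‖_{L^{2(q+1)}(Ω)} ≤ C ‖∇v‖_{L²(Ω)}` for all `v ∈ H¹_D(Ω)`. -/
def IsSobolevConstant (Ω S : Set Plane) (q : ℕ) (C : ℝ) : Prop :=
  0 < C ∧ ∀ v ∈ H1D Ω S,
    eLpNorm v.fst (2 * ((q : ℝ≥0∞) + 1)) (volume.restrict Ω) ≤ ENNReal.ofReal (C * gradNorm v)

/-- The exponent `2(q+1)/(2q+1)` of the source term. -/
def sourceExponent (q : ℕ) : ℝ≥0∞ := 2 * ((q : ℝ≥0∞) + 1) / (2 * (q : ℝ≥0∞) + 1)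

/-- `ρ = C ‖f‖` with the norm of `f` in `L^{2(q+1)/(2q+1)}(Ω)`. -/
def rho (Ω : Set Plane) (q : ℕ) (C : ℝ) (f : Plane → ℝ) : ℝ :=
  C * (eLpNorm f (sourceExponent q) (volume.restrict Ω)).toReal

/-- `L = λ (2q+1) C^{2(q+1)} (2ρ + ‖∇U₀‖)^{2q}`, with `lam` for `λ`. -/
def lipConst (q : ℕ) (lam C : ℝ) (f : Plane → ℝ) (U₀ : L2Pair Ω) : ℝ :=
  lam * (2 * q + 1) * C ^ (2 * (q + 1)) * (2 * rho Ω q C f + gradNorm U₀) ^ (2 * q)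

/-- `r_α = √((1 - α)² + α² L²)`. -/
def contractionRate (α L : ℝ) : ℝ := √((1 - α) ^ 2 + α ^ 2 * L ^ 2)

/-- `U ∈ W` solves the Galerkin formulation `a(U,v) + λ b(U;v) = ∫_Ω f v` for all `v ∈ W`. -/
def IsGalerkinSolution (q : ℕ) (lam : ℝ) (f : Plane → ℝ) (W : Submodule ℝ (L2Pair Ω))
    (U : L2Pair Ω) : Prop :=
  U ∈ W ∧ ∀ v ∈ W, formA U v + lam * formB q U v = load f v

/-- `U 1, U 2, … ∈ W` are generated from `U 0` by the Picard (Zarantonello) iteration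
`a(U_{n+1},v) = (1-α) a(U_n,v) + α (∫_Ω f v - λ b(U_n;v))` for all `v ∈ W`. -/
def IsPicardIteration (q : ℕ) (lam α : ℝ) (f : Plane → ℝ) (W : Submodule ℝ (L2Pair Ω))
    (U : ℕ → L2Pair Ω) : Prop :=
  ∀ n, U (n + 1) ∈ W ∧ ∀ v ∈ W,
    formA (U (n + 1)) v = (1 - α) * formA (U n) v + α * (load f v - lam * formB q (U n) v)

end SemilinearILG

end

/-! Write x = U - U_n, y = U - U_{n+1}, l(v) = λ(b(U;v) - b(U_n;v)). Combining the Galerkin equation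
with the iteration tested by y ∈ W gives ‖∇y‖² = (1-α)(∇x,∇y) - α l(y). Monotonicity of t ↦ t^(2q+1)
gives l(x) ≥ 0, and local Lipschitz continuity gives |l(v)| ≤ L‖∇x‖‖∇v‖. These facts alone yield
‖∇y‖ ≤ r_α‖∇x‖ (`norm_le_rate_mul_norm`): split y into a multiple of x and a part orthogonal to it
in the gradient product, then apply Cauchy–Schwarz in ℝ². No Riesz representative is needed, and x
need not lie in W, so U_0 is free.

The Lipschitz constant is only local, so the iterates must stay in a fixed ball. Since ‖∇U‖ ≤ ρ and
errors do not grow, ‖∇U_n‖ ≤ ρ + ‖∇(U - U_0)‖ ≤ 2ρ + ‖∇U_0‖, which is the radius in L. -/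

namespace SemilinearILG

/-! ### Hölder estimates for monomials of degree 2(q+1). -/

section Holder

variable {α : Type*} [MeasurableSpace α] {μ : Measure α} {q i j : ℕ} {u w d v : α → ℝ}

/-- Hölder's inequality for a monomial of degree `2(q+1)` in four functions. -/
theorem lintegral_monomial_le (hij : i + j = 2 * q) (hu : AEStronglyMeasurable u μ)
    (hw : AEStronglyMeasurable w μ) (hd : AEStronglyMeasurable d μ)
    (hv : AEStronglyMeasurable v μ) :
    ∫⁻ x, ‖u x ^ i * w x ^ j * d x * v x‖ₑ ∂μ ≤
      eLpNorm u (2 * ((q : ℝ≥0∞) + 1)) μ ^ i * eLpNorm w (2 * ((q : ℝ≥0∞) + 1)) μ ^ j *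
        eLpNorm d (2 * ((q : ℝ≥0∞) + 1)) μ * eLpNorm v (2 * ((q : ℝ≥0∞) + 1)) μ := by
  have hP : (2 * ((q : ℝ≥0∞) + 1)) = ((2 * (q + 1) : ℕ) : ℝ≥0∞) := by push_cast; rfl
  have hN : ∀ f : α → ℝ, eLpNorm f (2 * ((q : ℝ≥0∞) + 1)) μ
      = (∫⁻ x, ‖f x‖ₑ ^ (2 * ((q : ℝ) + 1)) ∂μ) ^ (1 / (2 * ((q : ℝ) + 1))) := by
    intro f
    rw [hP, eLpNorm_eq_lintegral_rpow_enorm_toReal (by simp) (ENNReal.natCast_ne_top _),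
      ENNReal.toReal_natCast]
    push_cast
    rfl
  have hr : (0 : ℝ) < 2 * ((q : ℝ) + 1) := by positivity
  -- Generalized Hölder with weights i, j, 1, 1 over 2(q+1); they sum to one because i + j = 2q.
  have key := ENNReal.lintegral_prod_norm_pow_le (μ := μ) (Finset.univ : Finset (Fin 4))
    (f := fun k x => ‖(![u, w, d, v] k) x‖ₑ ^ (2 * ((q : ℝ) + 1)))
    (p := fun k => ![(i : ℝ), j, 1, 1] k / (2 * ((q : ℝ) + 1)))
    (by
      intro k _
      fin_cases k
      exacts [hu.enorm.pow_const _, hw.enorm.pow_const _, hd.enorm.pow_const _,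
        hv.enorm.pow_const _])
    (by
      have hij' : (i : ℝ) + j = 2 * q := by exact_mod_cast hij
      simp only [Fin.sum_univ_four, Matrix.cons_val]
      field_simp
      linarith)
    (by
      intro k _
      fin_cases k <;> simp <;> positivity)
  have hpow : ∀ (a : ℝ≥0∞) (s : ℝ),
      (a ^ (2 * ((q : ℝ) + 1))) ^ (s / (2 * ((q : ℝ) + 1))) = a ^ s := by
    intro a s
    rw [← ENNReal.rpow_mul]
    congr 1
    field_simp
  have hN' : ∀ (f : α → ℝ) (s : ℝ),
      (∫⁻ x, ‖f x‖ₑ ^ (2 * ((q : ℝ) + 1)) ∂μ) ^ (s / (2 * ((q : ℝ) + 1))) =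
        eLpNorm f (2 * ((q : ℝ≥0∞) + 1)) μ ^ s := by
    intro f s
    rw [hN, ← ENNReal.rpow_mul]
    congr 1
    field_simp
  simp only [Fin.prod_univ_four, Matrix.cons_val, hpow] at key
  simp only [hN', ENNReal.rpow_one, ENNReal.rpow_natCast] at key
  simpa only [enorm_mul, enorm_pow] using key

theorem integrable_monomial (hij : i + j = 2 * q) (hu : MemLp u (2 * ((q : ℝ≥0∞) + 1)) μ)
    (hw : MemLp w (2 * ((q : ℝ≥0∞) + 1)) μ) (hd : MemLp d (2 * ((q : ℝ≥0∞) + 1)) μ)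
    (hv : MemLp v (2 * ((q : ℝ≥0∞) + 1)) μ) :
    Integrable (fun x => u x ^ i * w x ^ j * d x * v x) μ := by
  refine ⟨(((hu.1.pow i).mul (hw.1.pow j)).mul hd.1).mul hv.1, ?_⟩
  refine (lintegral_monomial_le hij hu.1 hw.1 hd.1 hv.1).trans_lt ?_
  exact ENNReal.mul_lt_top (ENNReal.mul_lt_top (ENNReal.mul_lt_top
    (ENNReal.pow_lt_top hu.2) (ENNReal.pow_lt_top hw.2)) hd.2) hv.2

theorem abs_integral_monomial_le {a b c e : ℝ} (ha : 0 ≤ a) (hb : 0 ≤ b) (hc : 0 ≤ c) (he : 0 ≤ e)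
    (hij : i + j = 2 * q) (hu : MemLp u (2 * ((q : ℝ≥0∞) + 1)) μ)
    (hw : MemLp w (2 * ((q : ℝ≥0∞) + 1)) μ) (hd : MemLp d (2 * ((q : ℝ≥0∞) + 1)) μ)
    (hv : MemLp v (2 * ((q : ℝ≥0∞) + 1)) μ)
    (hua : eLpNorm u (2 * ((q : ℝ≥0∞) + 1)) μ ≤ ENNReal.ofReal a)
    (hwb : eLpNorm w (2 * ((q : ℝ≥0∞) + 1)) μ ≤ ENNReal.ofReal b)
    (hdc : eLpNorm d (2 * ((q : ℝ≥0∞) + 1)) μ ≤ ENNReal.ofReal c)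
    (hve : eLpNorm v (2 * ((q : ℝ≥0∞) + 1)) μ ≤ ENNReal.ofReal e) :
    |∫ x, u x ^ i * w x ^ j * d x * v x ∂μ| ≤ a ^ i * b ^ j * c * e := by
  have h : ‖∫ x, u x ^ i * w x ^ j * d x * v x ∂μ‖ₑ ≤ ENNReal.ofReal (a ^ i * b ^ j * c * e) := by
    refine (enorm_integral_le_lintegral_enorm _).trans
      ((lintegral_monomial_le hij hu.1 hw.1 hd.1 hv.1).trans ?_)
    rw [ENNReal.ofReal_mul (by positivity), ENNReal.ofReal_mul (by positivity),
      ENNReal.ofReal_mul (by positivity), ENNReal.ofReal_pow ha, ENNReal.ofReal_pow hb]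
    gcongr
  rwa [← ofReal_norm, ENNReal.ofReal_le_ofReal_iff (by positivity), Real.norm_eq_abs] at h

end Holder

/-! ### The abstract contraction estimate. -/

/-- A solution `y` of one relaxed step `‖y‖² = (1 - α)⟪x, y⟫ - α l(y)` is bounded by the contraction
rate times `‖x‖` if `l` is linear, accretive at `x`, and bounded by `L‖x‖` on the span of `x, y`.
The data live in `E`, with gradients in the inner product space `F`. -/
theorem norm_le_rate_mul_norm {E F : Type*} [AddCommGroup E] [Module ℝ E] [NormedAddCommGroup F]
    [InnerProductSpace ℝ F] (G : E →ₗ[ℝ] F) (S : Submodule ℝ E) (l : E → ℝ)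
    (hadd : ∀ v ∈ S, ∀ w ∈ S, ∀ c : ℝ, l (v + c • w) = l v + c * l w) {L α : ℝ}
    (h0 : 0 ≤ α) (h1 : α ≤ 1) {x y : E} (hx : x ∈ S) (hy : y ∈ S) (hpos : 0 ≤ l x)
    (hbd : ∀ v ∈ S, |l v| ≤ L * ‖G x‖ * ‖G v‖)
    (heq : ‖G y‖ ^ 2 = (1 - α) * ⟪G x, G y⟫_ℝ - α * l y) :
    ‖G y‖ ≤ contractionRate α L * ‖G x‖ := by
  have hα : 0 ≤ 1 - α := by linarith
  suffices h : ‖G y‖ ^ 2 ≤ contractionRate α L * ‖G x‖ * ‖G y‖ by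
    rcases (norm_nonneg (G y)).eq_or_lt with hy0 | hy0
    · rw [← hy0, contractionRate]; positivity
    · exact le_of_mul_le_mul_right (by rwa [sq] at h) hy0
  have hr : α * L ≤ contractionRate α L :=
    Real.le_sqrt_of_sq_le (by nlinarith [sq_nonneg (1 - α)])
  set X := ‖G x‖ with hX
  have hX0 : 0 ≤ X := norm_nonneg _
  -- At an obtuse angle the inner product term can be dropped, and αL ≤ r_α already suffices.
  by_cases hs : ⟪G x, G y⟫_ℝ ≤ 0
  · have h2 := (abs_le.1 (hbd y hy)).1
    have h3 : (1 - α) * ⟪G x, G y⟫_ℝ ≤ 0 := mul_nonpos_of_nonneg_of_nonpos hα hs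
    have h4 : α * L * (X * ‖G y‖) ≤ contractionRate α L * (X * ‖G y‖) := by gcongr
    nlinarith [mul_le_mul_of_nonneg_left h2 h0]
  · push Not at hs
    have hXpos : 0 < X := by
      rcases hX0.eq_or_lt with h | h
      · have : G x = 0 := norm_eq_zero.1 h.symm
        simp [this] at hs
      · exact h
    -- Here s • G x is the orthogonal projection of G y onto G x. As s ≥ 0, the term -α s l(x) has
    -- the good sign, so the bound on l is spent only on the orthogonal remainder z.
    obtain ⟨s, hsdef⟩ : ∃ s, s = ⟪G x, G y⟫_ℝ / X ^ 2 := ⟨_, rfl⟩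
    have hsX : ⟪G x, G y⟫_ℝ = s * X ^ 2 := by rw [hsdef]; field_simp
    have hspos : 0 ≤ s := by rw [hsdef]; positivity
    set z := y + (-s) • x with hz
    have hzS : z ∈ S := S.add_mem hy (S.smul_mem _ hx)
    have hlz : l z = l y - s * l x := by rw [hz, hadd y hy x hx]; ring
    have hGz : G z = G y - s • G x := by simp [hz, sub_eq_add_neg]
    have hzn : ‖G z‖ ^ 2 = ‖G y‖ ^ 2 - (s * X) ^ 2 := by
      rw [hGz, norm_sub_sq_real, inner_smul_right, real_inner_comm, hsX, norm_smul, mul_pow,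
        Real.norm_eq_abs, sq_abs, ← hX]
      ring
    have h2 := (abs_le.1 (hbd z hzS)).1
    -- Cauchy–Schwarz in ℝ² for (1-α, αL) and (s‖G x‖, ‖G z‖); by Pythagoras the second vector has
    -- length ‖G y‖.
    have hCS : (1 - α) * (s * X) + α * L * ‖G z‖ ≤ contractionRate α L * ‖G y‖ := by
      rw [contractionRate, ← Real.sqrt_sq (norm_nonneg (G y)), ← Real.sqrt_mul (by positivity)]
      refine Real.le_sqrt_of_sq_le ?_
      have : ‖G y‖ ^ 2 = (s * X) ^ 2 + ‖G z‖ ^ 2 := by linarith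
      rw [this]
      nlinarith [sq_nonneg ((1 - α) * ‖G z‖ - α * L * (s * X))]
    have h5 := mul_le_mul_of_nonneg_left hCS hX0
    have h6 : 0 ≤ α * (s * l x) := by positivity
    have h7 := mul_le_mul_of_nonneg_left h2 h0
    rw [heq, hsX]
    nlinarith

/-- The radicand is 1 - α(2 - α(L² + 1)). -/
theorem contractionRate_lt_one {α L : ℝ} (h0 : 0 < α) (h : α < 2 / (L ^ 2 + 1)) :
    contractionRate α L < 1 := by
  rw [lt_div_iff₀ (by positivity)] at h
  rw [contractionRate, Real.sqrt_lt' one_pos]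
  nlinarith

/-! ### Monotonicity, Lipschitz and a priori bounds for the forms. -/

section Forms

variable {Ω S : Set Plane} {q : ℕ} {C : ℝ} {u v w : L2Pair Ω}

theorem gradNorm_nonneg (v : L2Pair Ω) : 0 ≤ gradNorm v := norm_nonneg _

theorem formA_eq_inner (v w : L2Pair Ω) : formA v w = ⟪v.snd, w.snd⟫_ℝ :=
  (L2.inner_def v.snd w.snd).symm

theorem formA_self (v : L2Pair Ω) : formA v v = gradNorm v ^ 2 := by
  rw [formA_eq_inner, real_inner_self_eq_norm_sq, gradNorm]

theorem IsSobolevConstant.memLp (hC : IsSobolevConstant Ω S q C) (hv : v ∈ H1D Ω S) :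
    MemLp v.fst (2 * ((q : ℝ≥0∞) + 1)) (volume.restrict Ω) :=
  ⟨Lp.aestronglyMeasurable _, (hC.2 v hv).trans_lt ENNReal.ofReal_lt_top⟩

theorem integrable_formB (hC : IsSobolevConstant Ω S q C) (hu : u ∈ H1D Ω S)
    (hv : v ∈ H1D Ω S) :
    Integrable (fun x => (u.fst x) ^ (2 * q + 1) * v.fst x) (volume.restrict Ω) := by
  simpa [pow_succ] using integrable_monomial (i := 2 * q) (j := 0) (add_zero _)
    (hC.memLp hu) (hC.memLp hu) (hC.memLp hu) (hC.memLp hv)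

theorem formB_add_smul (hC : IsSobolevConstant Ω S q C) (hu : u ∈ H1D Ω S) (hv : v ∈ H1D Ω S)
    (hw : w ∈ H1D Ω S) (c : ℝ) : formB q u (v + c • w) = formB q u v + c * formB q u w := by
  simp only [formB]
  rw [← integral_const_mul,
    ← integral_add (integrable_formB hC hu hv) ((integrable_formB hC hu hw).const_mul c)]
  refine integral_congr_ae ?_
  filter_upwards [Lp.coeFn_add v.fst (c • w.fst), Lp.coeFn_smul c w.fst] with x h1 h2
  rw [WithLp.add_fst, WithLp.smul_fst, h1, Pi.add_apply, h2, Pi.smul_apply, smul_eq_mul]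
  ring

/-- Odd powers are increasing, so the two factors of the integrand have the same sign pointwise. -/
theorem formB_sub_nonneg (hC : IsSobolevConstant Ω S q C) (hu : u ∈ H1D Ω S)
    (hw : w ∈ H1D Ω S) : 0 ≤ formB q u (u - w) - formB q w (u - w) := by
  have hd := Submodule.sub_mem _ hu hw
  simp only [formB]
  rw [← integral_sub (integrable_formB hC hu hd) (integrable_formB hC hw hd)]
  refine integral_nonneg_of_ae ?_
  filter_upwards [Lp.coeFn_sub u.fst w.fst] with x hx
  rw [WithLp.sub_fst, hx, Pi.sub_apply, Pi.zero_apply, ← sub_mul]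
  have hmono := (odd_two_mul_add_one q).strictMono_pow (R := ℝ)
  rcases le_total (u.fst x) (w.fst x) with h | h
  · exact mul_nonneg_of_nonpos_of_nonpos (sub_nonpos.2 (hmono.monotone h)) (sub_nonpos.2 h)
  · exact mul_nonneg (sub_nonneg.2 (hmono.monotone h)) (sub_nonneg.2 h)

theorem formB_self_nonneg (u : L2Pair Ω) : 0 ≤ formB q u u := by
  refine integral_nonneg fun x => ?_
  have : (u.fst x) ^ (2 * q + 1) * u.fst x = (u.fst x ^ (q + 1)) ^ 2 := by ring
  simp only [this]
  positivity

/-- Local Lipschitz continuity of `u ↦ b(u; ·)`. -/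
theorem abs_formB_sub_le (hC : IsSobolevConstant Ω S q C) (hu : u ∈ H1D Ω S)
    (hw : w ∈ H1D Ω S) (hv : v ∈ H1D Ω S) {M : ℝ} (huM : gradNorm u ≤ M) (hwM : gradNorm w ≤ M) :
    |formB q u v - formB q w v| ≤
      (2 * q + 1) * C ^ (2 * (q + 1)) * M ^ (2 * q) * gradNorm (u - w) * gradNorm v := by
  have hd := Submodule.sub_mem _ hu hw
  have hM : 0 ≤ M := (gradNorm_nonneg u).trans huM
  have hC0 := hC.1.le
  have hij : ∀ i ∈ Finset.range (2 * q + 1), i + (2 * q - i) = 2 * q := by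
    intro i hi
    rw [Finset.mem_range] at hi
    omega
  -- Factorization of u^(2q+1) - w^(2q+1) by u - w; its 2q+1 summands, all bounded alike, produce
  -- the factor 2q+1.
  have hsum : formB q u v - formB q w v = ∑ i ∈ Finset.range (2 * q + 1),
      ∫ x in Ω, u.fst x ^ i * w.fst x ^ (2 * q - i) * (u - w).fst x * v.fst x := by
    rw [← integral_finsetSum _ fun i hi => integrable_monomial (hij i hi) (hC.memLp hu)
      (hC.memLp hw) (hC.memLp hd) (hC.memLp hv)]
    simp only [formB]
    rw [← integral_sub (integrable_formB hC hu hv) (integrable_formB hC hw hv)]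
    refine integral_congr_ae ?_
    filter_upwards [Lp.coeFn_sub u.fst w.fst] with x hx
    simp only [WithLp.sub_fst, hx, Pi.sub_apply]
    rw [← sub_mul, ← geom_sum₂_mul, ← Finset.sum_mul, ← Finset.sum_mul]
    simp
  have hterm : ∀ i ∈ Finset.range (2 * q + 1),
      |∫ x in Ω, u.fst x ^ i * w.fst x ^ (2 * q - i) * (u - w).fst x * v.fst x| ≤
        C ^ (2 * (q + 1)) * M ^ (2 * q) * gradNorm (u - w) * gradNorm v := by
    intro i hi
    have hle : ∀ {y : L2Pair Ω}, y ∈ H1D Ω S → gradNorm y ≤ M →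
        eLpNorm y.fst (2 * ((q : ℝ≥0∞) + 1)) (volume.restrict Ω) ≤ ENNReal.ofReal (C * M) :=
      fun hy hyM => (hC.2 _ hy).trans (ENNReal.ofReal_le_ofReal (by gcongr))
    refine (abs_integral_monomial_le (by positivity) (by positivity)
      (mul_nonneg hC0 (gradNorm_nonneg _)) (mul_nonneg hC0 (gradNorm_nonneg _)) (hij i hi)
      (hC.memLp hu) (hC.memLp hw) (hC.memLp hd) (hC.memLp hv) (hle hu huM) (hle hw hwM)
      (hC.2 _ hd) (hC.2 _ hv)).trans_eq ?_
    rw [← pow_add, hij i hi]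
    ring
  rw [hsum]
  refine (Finset.abs_sum_le_sum_abs _ _).trans ((Finset.sum_le_sum hterm).trans_eq ?_)
  rw [Finset.sum_const, Finset.card_range, nsmul_eq_mul]
  push_cast
  ring

instance holderTriple_sourceExponent (q : ℕ) :
    ENNReal.HolderTriple (sourceExponent q) (2 * ((q : ℝ≥0∞) + 1)) 1 where
  inv_add_inv_eq_inv := by
    have h : (2 * ((q : ℝ≥0∞) + 1)) ≠ 0 := by simp
    have h' : (2 * ((q : ℝ≥0∞) + 1)) ≠ ⊤ := by finiteness
    rw [sourceExponent, ENNReal.inv_div (Or.inl (by finiteness)) (Or.inl (by simp)),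
      ← one_div, ENNReal.div_add_div_same, inv_one, add_assoc, one_add_one_eq_two,
      show 2 * (q : ℝ≥0∞) + 2 = 2 * ((q : ℝ≥0∞) + 1) by ring, ENNReal.div_self h h']

theorem load_le {f : Plane → ℝ} (hf : MemLp f (sourceExponent q) (volume.restrict Ω))
    (hC : IsSobolevConstant Ω S q C) (hv : v ∈ H1D Ω S) :
    load f v ≤ rho Ω q C f * gradNorm v := by
  have hC0 := hC.1.le
  have h : ‖load f v‖ₑ ≤ ENNReal.ofReal (rho Ω q C f * gradNorm v) := by
    refine (enorm_integral_le_lintegral_enorm _).trans ?_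
    rw [← eLpNorm_one_eq_lintegral_enorm]
    refine (eLpNorm_smul_le_mul_eLpNorm (p := sourceExponent q) (q := 2 * ((q : ℝ≥0∞) + 1))
      (Lp.aestronglyMeasurable v.fst) hf.1).trans ?_
    rw [rho, mul_comm C, mul_assoc, ENNReal.ofReal_mul ENNReal.toReal_nonneg,
      ENNReal.ofReal_toReal hf.2.ne]
    gcongr
    exact hC.2 v hv
  have hρ : 0 ≤ rho Ω q C f := mul_nonneg hC0 ENNReal.toReal_nonneg
  rw [← ofReal_norm,
    ENNReal.ofReal_le_ofReal_iff (mul_nonneg hρ (gradNorm_nonneg v))] at h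
  exact (Real.le_norm_self _).trans h

/-- A priori bound for the Galerkin solution. -/
theorem IsGalerkinSolution.gradNorm_le {lam : ℝ} (hlam : 0 ≤ lam) {f : Plane → ℝ}
    (hf : MemLp f (sourceExponent q) (volume.restrict Ω)) (hC : IsSobolevConstant Ω S q C)
    {W : Submodule ℝ (L2Pair Ω)} (hW : W ≤ H1D Ω S) (hu : IsGalerkinSolution q lam f W u) :
    gradNorm u ≤ rho Ω q C f := by
  -- Testing with u itself: b(u;u) ≥ 0 drops out, leaving ‖∇u‖² ≤ ρ‖∇u‖.
  have h := hu.2 u hu.1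
  rw [formA_self] at h
  have h1 := load_le hf hC (hW hu.1)
  have h2 : 0 ≤ lam * formB q u u := mul_nonneg hlam (formB_self_nonneg u)
  rcases (gradNorm_nonneg u).eq_or_lt with h0 | h0
  · rw [← h0]
    exact mul_nonneg hC.1.le ENNReal.toReal_nonneg
  · exact le_of_mul_le_mul_right (by nlinarith) h0

theorem gradNorm_sub_le_add (u w : L2Pair Ω) : gradNorm (u - w) ≤ gradNorm u + gradNorm w := by
  simpa only [gradNorm, WithLp.sub_snd] using norm_sub_le u.snd w.snd

/-- One step of the Picard iteration contracts the error, as long as the current iterate obeys the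
bound that enters the Lipschitz constant. -/
theorem gradNorm_sub_step_le {lam α M : ℝ} (hlam : 0 ≤ lam) (h0 : 0 ≤ α) (h1 : α ≤ 1)
    {f : Plane → ℝ} (hC : IsSobolevConstant Ω S q C) {W : Submodule ℝ (L2Pair Ω)}
    (hW : W ≤ H1D Ω S) (hu : IsGalerkinSolution q lam f W u) (hw : w ∈ H1D Ω S)
    (hvW : v ∈ W) (hv : ∀ y ∈ W,
      formA v y = (1 - α) * formA w y + α * (load f y - lam * formB q w y))
    (huM : gradNorm u ≤ M) (hwM : gradNorm w ≤ M) :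
    gradNorm (u - v) ≤
      contractionRate α (lam * (2 * q + 1) * C ^ (2 * (q + 1)) * M ^ (2 * q)) *
        gradNorm (u - w) := by
  have hM : 0 ≤ M := (gradNorm_nonneg u).trans huM
  have hC0 := hC.1.le
  have huS := hW hu.1
  have hyW : u - v ∈ W := W.sub_mem hu.1 hvW
  refine norm_le_rate_mul_norm (WithLp.sndₗ 2 ℝ _ _) (H1D Ω S)
    (fun y => lam * (formB q u y - formB q w y)) ?_ h0 h1
    (Submodule.sub_mem _ huS hw) (hW hyW) (mul_nonneg hlam (formB_sub_nonneg hC huS hw)) ?_ ?_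
  · intro y hy z hz c
    simp only [formB_add_smul hC huS hy hz, formB_add_smul hC hw hy hz]
    ring
  · intro y hy
    rw [abs_mul, abs_of_nonneg hlam]
    refine (mul_le_mul_of_nonneg_left (abs_formB_sub_le hC huS hw hy huM hwM) hlam).trans_eq ?_
    simp only [gradNorm, WithLp.sndₗ_apply]
    ring
  · have e1 := hu.2 _ hyW
    have e2 := hv _ hyW
    simp only [formA_eq_inner] at e1 e2
    simp only [WithLp.sndₗ_apply]
    rw [← real_inner_self_eq_norm_sq]
    nth_rewrite 1 [WithLp.sub_snd]
    rw [inner_sub_left, WithLp.sub_snd u w, inner_sub_left]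
    -- α times the Galerkin equation minus the iteration: the load cancels.
    linear_combination (1 - (1 - α)) * e1 - e2

/-- On a bounded domain the gradient norm controls the `H¹(Ω)`-norm on `H¹_D(Ω)`. -/
theorem exists_norm_le_gradNorm (hΩ : Bornology.IsBounded Ω) (hC : IsSobolevConstant Ω S q C) :
    ∃ K : ℝ, ∀ v ∈ H1D Ω S, ‖v‖ ≤ K * gradNorm v := by
  have : IsFiniteMeasure (volume.restrict Ω) := ⟨by simpa using hΩ.measure_lt_top⟩
  -- The Hölder factor |Ω|^(1/2 - 1/(2(q+1))) of the embedding of L^{2(q+1)}(Ω) into L²(Ω).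
  set A := volume.restrict Ω Set.univ ^
    (1 / (2 : ℝ≥0∞).toReal - 1 / (2 * ((q : ℝ≥0∞) + 1)).toReal) with hA
  have h2q : (2 : ℝ≥0∞) ≤ 2 * ((q : ℝ≥0∞) + 1) := by
    simpa using mul_le_mul_right (le_add_self : (1 : ℝ≥0∞) ≤ q + 1) 2
  have hAtop : A ≠ ⊤ := by
    refine ENNReal.rpow_ne_top_of_nonneg ?_ (measure_ne_top _ _)
    rw [sub_nonneg]
    have : (2 : ℝ≥0∞).toReal ≤ (2 * ((q : ℝ≥0∞) + 1)).toReal :=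
      ENNReal.toReal_mono (by finiteness) h2q
    exact one_div_le_one_div_of_le (by simp) this
  refine ⟨C * A.toReal + 1, fun v hv => ?_⟩
  have hg := gradNorm_nonneg v
  have hC0 := hC.1.le
  have hfst : ‖v.fst‖ ≤ C * A.toReal * gradNorm v := by
    rw [Lp.norm_def]
    refine ENNReal.toReal_le_of_le_ofReal (by positivity) ?_
    refine (eLpNorm_le_eLpNorm_mul_rpow_measure_univ h2q (Lp.aestronglyMeasurable v.fst)).trans ?_
    rw [mul_right_comm, ENNReal.ofReal_mul (by positivity), ENNReal.ofReal_toReal hAtop]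
    gcongr
    exact hC.2 v hv
  rw [WithLp.prod_norm_eq_of_L2]
  refine (Real.sqrt_le_sqrt ?_).trans_eq (Real.sqrt_sq (by positivity))
  rw [show ‖v.snd‖ = gradNorm v from rfl]
  have h3 : 0 ≤ C * A.toReal * gradNorm v := by positivity
  nlinarith [norm_nonneg v.fst]

end Forms

end SemilinearILG

/-! ### Iteration of the contraction and convergence. -/

open SemilinearILG in
theorem proposition3p3 {m : ℕ} (P : Polygon Plane m) (Ω : Set Plane) (hΩ : IsOpenPolygon P Ω)
    (D : Set (Fin m)) (hD : D.Nonempty) (q : ℕ) (lam : ℝ) (hlam : 0 < lam)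
    (f : Plane → ℝ) (hf : MemLp f (sourceExponent q) (volume.restrict Ω))
    (C : ℝ) (hC : IsSobolevConstant Ω (edgeUnion P D) q C)
    (W : Submodule ℝ (L2Pair Ω)) (hW : W ≤ H1D Ω (edgeUnion P D)) (hfin : FiniteDimensional ℝ W)
    (Ugal : L2Pair Ω) (hUgal : IsGalerkinSolution q lam f W Ugal)
    (U : ℕ → L2Pair Ω) (hU0 : U 0 ∈ H1D Ω (edgeUnion P D))
    (α : ℝ)
    (hα : α ∈ Set.Ioc 0 1 ∩ Set.Ioo 0 (2 / ((lipConst q lam C f (U 0)) ^ 2 + 1)))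
    (hU : IsPicardIteration q lam α f W U) :
    contractionRate α (lipConst q lam C f (U 0)) < 1 ∧
    (∀ n, gradNorm (Ugal - U (n + 1)) ≤
      contractionRate α (lipConst q lam C f (U 0)) ^ (n + 1) * gradNorm (Ugal - U 0)) ∧
    Tendsto (fun n => gradNorm (Ugal - U n)) atTop (𝓝 0) ∧
    Tendsto U atTop (𝓝 Ugal) := by
  obtain ⟨⟨hα0, hα1⟩, -, hαL⟩ := hα
  set r := contractionRate α (lipConst q lam C f (U 0)) with hr
  have hr0 : 0 ≤ r := Real.sqrt_nonneg _
  have hr1 : r < 1 := contractionRate_lt_one hα0 hαL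
  have hρ : gradNorm Ugal ≤ rho Ω q C f := hUgal.gradNorm_le hlam.le hf hC hW
  have hmem : ∀ n, U n ∈ H1D Ω (edgeUnion P D) := fun n => by
    cases n with
    | zero => exact hU0
    | succ n => exact hW (hU n).1
  have hbound : ∀ n, gradNorm (Ugal - U n) ≤ r ^ n * gradNorm (Ugal - U 0) := by
    intro n
    induction n with
    | zero => simp
    | succ n ih =>
      -- The induction hypothesis also confines U_n to the ball on which L is a valid Lipschitz
      -- constant.
      have hle : gradNorm (Ugal - U n) ≤ gradNorm (Ugal - U 0) :=
        ih.trans (mul_le_of_le_one_left (gradNorm_nonneg _) (pow_le_one₀ hr0 hr1.le))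
      have hUn : gradNorm (U n) ≤ 2 * rho Ω q C f + gradNorm (U 0) := by
        have h1 := gradNorm_sub_le_add Ugal (Ugal - U n)
        rw [sub_sub_cancel] at h1
        linarith [gradNorm_sub_le_add Ugal (U 0)]
      have hstep := gradNorm_sub_step_le hlam.le hα0.le hα1 hC hW hUgal (hmem n) (hU n).1 (hU n).2
        (M := 2 * rho Ω q C f + gradNorm (U 0))
        (by linarith [gradNorm_nonneg Ugal, gradNorm_nonneg (U 0)]) hUn
      refine hstep.trans ?_
      rw [pow_succ', mul_assoc r]
      exact mul_le_mul_of_nonneg_left ih hr0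
  have htend : Tendsto (fun n => gradNorm (Ugal - U n)) atTop (𝓝 0) := by
    refine squeeze_zero (fun n => gradNorm_nonneg _) hbound ?_
    simpa using (tendsto_pow_atTop_nhds_zero_of_lt_one hr0 hr1).mul_const _
  refine ⟨hr1, fun n => hbound (n + 1), htend, ?_⟩
  obtain ⟨K, hK⟩ := exists_norm_le_gradNorm hΩ.isBounded hC
  rw [tendsto_iff_norm_sub_tendsto_zero]
  refine squeeze_zero (fun n => norm_nonneg _)
    (fun n => (norm_sub_rev _ _).trans_le (hK _ (Submodule.sub_mem _ (hW hUgal.1) (hmem n)))) ?_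
  simpa using htend.const_mul K
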